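/- Let $\sigma_x,\sigma_y>0$, $-1<\rho<1$ and $\Sigma=\begin{pmatrix}\sigma_x^2&\rho\sigma_x\sigma_y\\ \rho\sigma_x\sigma_y&\sigma_y^2\end{pmatrix}$, and let $(\xi,\eta)\sim N(\mathbf 0,\Sigma)$. Let $S\subset\mathbb R^2$ be nonempty and compact. In the bivariate final-offer arbitration game on $S$, Player I (the minimizer) chooses $\mathbf a=(x_1,y_1)\in S$, Player II (the maximizer) chooses $\mathbf b=(x_2,y_2)\in S$, and an arbiter who considers $(\xi,\eta)$ to be the fair settlement selects the offer closer to $(\xi,\eta)$ in Euclidean ($L_2$) distance. The expected payoff to Player II from Player I is $$K(\mathbf a,\mathbf b)=\begin{cases}x_1+y_1,&\mathbf a=\mathbf b,\\ (x_1+y_1)\,P\big((\xi,\eta)\in C_1\big)+(x_2+y_2)\,P\big((\xi,\eta)\in C_2\big),&\mathbf a\neq\mathbf b,\end{cases}$$ where $C_1$ (respectively $C_2$) is the set of points of $\mathbb R^2$ strictly closer to $\mathbf a$ than to $\mathbf b$ (respectively strictly closer to $\mathbf b$ than to $\mathbf a$). Mixed strategies are Borel probability measures on $S$, and $K(F_1,F_2)=\int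 K\,d(F_1\otimes F_2)$. Then all these integrals exist and the game has a value in mixed strategies: there is a real number $v$ with $$\inf_{F_1}\sup_{F_2}K(F_1,F_2)=\sup_{F_2}\inf_{F_1}K(F_1,F_2)=v .$$ If moreover $S$ is symmetric about the origin ($\mathbf a\in S\Rightarrow-\mathbf a\in S$), then the value is $v=0$. -/

import Mathlib

open MeasureTheory ProbabilityTheory

noncomputable section

/-! ## Values of zero-sum games in mixed strategies

Player I chooses a point of `X` and is the minimizer, Player II chooses a point of `Y` and is the
maximizer; `K a b` is the payoff to Player II from Player I. Mixed strategies are probability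
measures; the players randomize independently. -/

/-- The expected payoff when the players use the mixed strategies `F` and `G`. -/
def mixedPayoff {X Y : Type*} [MeasurableSpace X] [MeasurableSpace Y] (K : X → Y → ℝ)
    (F : ProbabilityMeasure X) (G : ProbabilityMeasure Y) : ℝ :=
  ∫ p : X × Y, K p.1 p.2 ∂((F : Measure X).prod (G : Measure Y))

/-- The upper value `inf_F sup_G K(F, G)`, in the extended reals. -/
def upperValue {X Y : Type*} [MeasurableSpace X] [MeasurableSpace Y] (K : X → Y → ℝ) : EReal :=
  ⨅ F : ProbabilityMeasure X, ⨆ G : ProbabilityMeasure Y, (mixedPayoff K F G : EReal)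

/-- The lower value `sup_G inf_F K(F, G)`, in the extended reals. -/
def lowerValue {X Y : Type*} [MeasurableSpace X] [MeasurableSpace Y] (K : X → Y → ℝ) : EReal :=
  ⨆ G : ProbabilityMeasure Y, ⨅ F : ProbabilityMeasure X, (mixedPayoff K F G : EReal)

/-- The zero-sum game with payoff `K` has the value `v` in mixed strategies: all expected payoffs
are well defined, and the upper and the lower value are both equal to `v`. -/
structure HasGameValue {X Y : Type*} [MeasurableSpace X] [MeasurableSpace Y] (K : X → Y → ℝ)
    (v : ℝ) : Prop where
  integrable : ∀ (F : ProbabilityMeasure X) (G : ProbabilityMeasure Y),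
    Integrable (fun p : X × Y => K p.1 p.2) ((F : Measure X).prod (G : Measure Y))
  upper_eq : upperValue K = (v : EReal)
  lower_eq : lowerValue K = (v : EReal)

/-! ## Bivariate final-offer arbitration -/

/-- The covariance matrix with standard deviations `σx`, `σy` and correlation `ρ`. -/
def covMatrix2 (σx σy ρ : ℝ) : Matrix (Fin 2) (Fin 2) ℝ :=
  !![σx ^ 2, ρ * σx * σy; ρ * σx * σy, σy ^ 2]

/-- The law `N(0, Σ)` of the settlement `(ξ, η)` that the arbiter considers fair. -/
def arbiterLaw (σx σy ρ : ℝ) : Measure (EuclideanSpace ℝ (Fin 2)) :=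
  multivariateGaussian 0 (covMatrix2 σx σy ρ)

/-- The settlements strictly closer, in Euclidean distance, to Player I's offer `a` than to
Player II's offer `b`. -/
def closerToI (a b : EuclideanSpace ℝ (Fin 2)) : Set (EuclideanSpace ℝ (Fin 2)) :=
  {z | (a 0 - z 0) ^ 2 + (a 1 - z 1) ^ 2 < (b 0 - z 0) ^ 2 + (b 1 - z 1) ^ 2}

/-- The settlements strictly closer, in Euclidean distance, to Player II's offer `b` than to
Player I's offer `a`. -/
def closerToII (a b : EuclideanSpace ℝ (Fin 2)) : Set (EuclideanSpace ℝ (Fin 2)) :=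
  {z | (a 0 - z 0) ^ 2 + (a 1 - z 1) ^ 2 > (b 0 - z 0) ^ 2 + (b 1 - z 1) ^ 2}

open Classical in
/-- The expected payoff to Player II from Player I for the pure offers `a` (Player I) and `b`
(Player II), when the fair settlement has law `P`. -/
def foaPayoff (P : Measure (EuclideanSpace ℝ (Fin 2))) (a b : EuclideanSpace ℝ (Fin 2)) : ℝ :=
  if a = b then a 0 + a 1
  else (a 0 + a 1) * P.real (closerToI a b) + (b 0 + b 1) * P.real (closerToII a b)

/-- The payoff of the game in which both players are restricted to offers in `S`. -/
def foaGame (σx σy ρ : ℝ) (S : Set (EuclideanSpace ℝ (Fin 2))) (a b : S) : ℝ :=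
  foaPayoff (arbiterLaw σx σy ρ) a b

end

/-!
The game is continuous, so a minimax theorem applies; its value for a symmetric set of offers is
then forced by a sign-reversing symmetry.

*Continuity of the payoff* (`continuous_foaPayoff`). Since `ρ ^ 2 < 1`, the law `N(0, Σ)` is
nondegenerate and gives no mass to lines, in particular to the bisector of two different offers
(`bisectorsNull_arbiterLaw`). Away from the diagonal the probabilities of the two half-planes
therefore depend continuously on the offers. They also add up to `1`, so the payoff is a weighted
mean of the totals of the two offers, and this gives continuity on the diagonal, where the
half-planes themselves have no limit.

*Minimax* (`exists_hasGameValue_of_continuous`). For a continuous payoff on compact metric spaces,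
uniform continuity lets a finite net represent Player II's pure strategies up to `ε`. The vectors of
payoffs that Player I can achieve against the net form a convex set. Either it meets the open
orthant of vectors below `c`, and Player I can keep the payoff below `c + ε`, or a hyperplane
separates it from this orthant; its normal vector, normalized, is a mixed strategy on the net which
secures `c` to Player II. No topology on the space of mixed strategies is needed.

*Symmetric sets of offers* (`HasGameValue.eq_zero_of_antisymm`). As `N(0, Σ)` is invariant under
`z ↦ -z`, reflecting both offers and exchanging the players reverses the sign of the payoff
(`foaPayoff_neg_neg`). Answering a mixed strategy by its reflection hence yields payoff `0`, whoever
answers, so the upper value is at least `0` and the lower value at most `0`.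
-/

/-! ### Minimax theorem for continuous payoffs on compact metric spaces -/

section Minimax

variable {X Y : Type*} [MeasurableSpace X] [MeasurableSpace Y]

/-- A separation argument: if no vector `m` in the convex set `A` lies strictly below the
constant vector `c`, some probability vector `w` satisfies `c ≤ ∑ j, w j * m j` on all of `A`. -/
theorem exists_weights_of_forall_exists_le {ι : Type*} [Fintype ι] {A : Set (ι → ℝ)}
    (hA : Convex ℝ A) (hne : A.Nonempty) {c : ℝ} (h : ∀ m ∈ A, ∃ j, c ≤ m j) :
    ∃ w : ι → ℝ, (∀ j, 0 ≤ w j) ∧ ∑ j, w j = 1 ∧ ∀ m ∈ A, c ≤ ∑ j, w j * m j := by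
  classical
  set B : Set (ι → ℝ) := Set.univ.pi fun _ => Set.Iio c with hB
  have hBo : IsOpen B := isOpen_set_pi Set.finite_univ fun _ _ => isOpen_Iio
  have hBc : Convex ℝ B := convex_pi fun _ _ => convex_Iio c
  have hd : Disjoint B A := by
    refine Set.disjoint_left.2 fun m hmB hmA => ?_
    obtain ⟨j, hj⟩ := h m hmA
    exact absurd (hmB j trivial) (not_lt.2 hj)
  obtain ⟨f, u, hfB, hfA⟩ := geometric_hahn_banach_open hBc hBo hA hd
  set w : ι → ℝ := fun j => f (Pi.single j 1) with hw
  have hf : ∀ x : ι → ℝ, f x = ∑ j, w j * x j := by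
    intro x
    conv_lhs => rw [pi_eq_sum_univ' x, map_sum]
    exact Finset.sum_congr rfl fun j _ => by rw [map_smul, smul_eq_mul, mul_comm]
  have hw0 : ∀ j, 0 ≤ w j := by
    intro j
    by_contra! hj
    -- Moving far enough in the direction `-e j` stays below `c` but makes `f` exceed `u`.
    set t : ℝ := (|u| + |f fun _ => c - 1|) / (-w j) with ht
    have htp : 0 ≤ t := div_nonneg (by positivity) (by linarith)
    have hmem : (fun _ => c - 1) - t • Pi.single j (1 : ℝ) ∈ B := by
      intro k _
      have : 0 ≤ (Pi.single j (1 : ℝ) : ι → ℝ) k := by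
        by_cases hk : k = j <;> simp [hk]
      have := mul_nonneg htp this
      simp only [Pi.sub_apply, Pi.smul_apply, smul_eq_mul, Set.mem_Iio]
      linarith
    have h1 := hfB _ hmem
    rw [map_sub, map_smul, smul_eq_mul] at h1
    have h2 : t * w j = -(|u| + |f fun _ => c - 1|) := by
      rw [ht]; field_simp [hj.ne]
    change _ - t * w j < u at h1
    linarith [le_abs_self u, neg_abs_le (f fun _ => c - 1)]
  obtain ⟨m₀, hm₀⟩ := hne
  have hWnn : 0 ≤ ∑ j, w j := Finset.sum_nonneg fun j _ => hw0 j
  have hWpos : 0 < ∑ j, w j := by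
    refine lt_of_le_of_ne hWnn fun h0 => ?_
    have hz : ∀ j, w j = 0 := fun j =>
      (Finset.sum_eq_zero_iff_of_nonneg fun j _ => hw0 j).1 h0.symm j (Finset.mem_univ j)
    have h1 := hfB (fun _ => c - 1) fun _ _ => by simp
    have h2 := hfA m₀ hm₀
    rw [hf] at h1 h2
    simp only [hz, zero_mul, Finset.sum_const_zero] at h1 h2
    linarith
  set W := ∑ j, w j with hW
  have hcu : W * c ≤ u := by
    refine le_of_forall_pos_le_add fun ε hε => ?_
    have h1 := hfB (fun _ => c - ε / W) fun _ _ => by simpa using div_pos hε hWpos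
    rw [hf, ← Finset.sum_mul, mul_sub, mul_div_cancel₀ _ hWpos.ne'] at h1
    linarith
  refine ⟨fun j => w j / W, fun j => div_nonneg (hw0 j) hWnn, ?_, fun m hm => ?_⟩
  · rw [← Finset.sum_div, div_self hWpos.ne']
  · have h1 := hfA m hm
    rw [hf] at h1
    simp_rw [div_mul_eq_mul_div]
    rw [← Finset.sum_div, le_div_iff₀ hWpos]
    linarith

/-- The mixed strategy playing `b j` with probability `w j`. -/
theorem exists_probabilityMeasure_integral_eq_sum {ι : Type*} [Fintype ι]
    [MeasurableSingletonClass Y] (b : ι → Y) {w : ι → ℝ} (hw : ∀ j, 0 ≤ w j) (hw1 : ∑ j, w j = 1) :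
    ∃ G : ProbabilityMeasure Y, ∀ g : Y → ℝ, ∫ y, g y ∂(G : Measure Y) = ∑ j, w j * g (b j) := by
  refine ⟨⟨∑ j, ENNReal.ofReal (w j) • Measure.dirac (b j), ⟨?_⟩⟩, fun g => ?_⟩
  · simp only [Measure.coe_finsetSum, Measure.coe_smul, Finset.sum_apply, Pi.smul_apply,
      measure_univ, smul_eq_mul, mul_one]
    rw [← ENNReal.ofReal_sum_of_nonneg fun j _ => hw j, hw1, ENNReal.ofReal_one]
  · rw [ProbabilityMeasure.coe_mk, integral_finsetSum_measure fun j _ =>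
      (integrable_dirac (by simp)).smul_measure ENNReal.ofReal_ne_top]
    refine Finset.sum_congr rfl fun j _ => ?_
    rw [integral_smul_measure, integral_dirac, ENNReal.toReal_ofReal (hw j), smul_eq_mul]

/-- The payoffs of Player I's mixed strategies against finitely many pure strategies of Player II
form a convex set. -/
theorem convex_range_integral {ι : Type*} {g : X → ι → ℝ}
    (hg : ∀ j, ∀ F : ProbabilityMeasure X, Integrable (fun a => g a j) (F : Measure X)) :
    Convex ℝ (Set.range fun (F : ProbabilityMeasure X) (j : ι) =>
      ∫ a, g a j ∂(F : Measure X)) := by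
  rintro _ ⟨F₁, rfl⟩ _ ⟨F₂, rfl⟩ s t hs ht hst
  refine ⟨⟨ENNReal.ofReal s • (F₁ : Measure X) + ENNReal.ofReal t • (F₂ : Measure X), ⟨?_⟩⟩, ?_⟩
  · simp [← ENNReal.ofReal_add hs ht, hst]
  · ext j
    simp only [ProbabilityMeasure.coe_mk, Pi.add_apply, Pi.smul_apply]
    rw [integral_add_measure ((hg j F₁).smul_measure ENNReal.ofReal_ne_top)
      ((hg j F₂).smul_measure ENNReal.ofReal_ne_top), integral_smul_measure,
      integral_smul_measure, ENNReal.toReal_ofReal hs, ENNReal.toReal_ofReal ht]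

variable [MetricSpace X] [CompactSpace X] [BorelSpace X]
  [MetricSpace Y] [CompactSpace Y] [BorelSpace Y] {K : X → Y → ℝ}

theorem integrable_prod_of_continuous (hK : Continuous fun p : X × Y => K p.1 p.2)
    (F : ProbabilityMeasure X) (G : ProbabilityMeasure Y) :
    Integrable (fun p : X × Y => K p.1 p.2) ((F : Measure X).prod (G : Measure Y)) :=
  hK.integrable_of_hasCompactSupport (HasCompactSupport.of_compactSpace _)

theorem mixedPayoff_eq_integral_integral (hK : Continuous fun p : X × Y => K p.1 p.2)
    (F : ProbabilityMeasure X) (G : ProbabilityMeasure Y) :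
    mixedPayoff K F G = ∫ b, ∫ a, K a b ∂(F : Measure X) ∂(G : Measure Y) :=
  integral_prod_symm _ (integrable_prod_of_continuous hK F G)

/-- The alternative behind the minimax theorem: Player I can hold every payoff below `c + ε`, or
Player II can secure `c`. Player II's pure strategies are replaced by a finite net up to `ε`. -/
theorem exists_forall_mixedPayoff_le_or_le [Nonempty X]
    (hK : Continuous fun p : X × Y => K p.1 p.2)
    (c : ℝ) {ε : ℝ} (hε : 0 < ε) :
    (∃ F : ProbabilityMeasure X, ∀ G : ProbabilityMeasure Y, mixedPayoff K F G ≤ c + ε) ∨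
      ∃ G : ProbabilityMeasure Y, ∀ F : ProbabilityMeasure X, c ≤ mixedPayoff K F G := by
  have hint : ∀ b, ∀ F : ProbabilityMeasure X, Integrable (fun a => K a b) (F : Measure X) :=
    fun b F => (hK.comp (by fun_prop : Continuous fun a => (a, b))).integrable_of_hasCompactSupport
      (HasCompactSupport.of_compactSpace _)
  obtain ⟨δ, hδ, hKδ⟩ := Metric.uniformContinuous_iff.1
    (CompactSpace.uniformContinuous_of_continuous hK) ε hε
  obtain ⟨t, -, htf, htc⟩ := finite_cover_balls_of_compact (isCompact_univ (X := Y)) hδ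
  have := htf.fintype
  by_cases h : ∃ F : ProbabilityMeasure X, ∀ j : t, ∫ a, K a j ∂(F : Measure X) < c
  · obtain ⟨F, hF⟩ := h
    refine Or.inl ⟨F, fun G => ?_⟩
    have hb : ∀ b, ∫ a, K a b ∂(F : Measure X) ≤ c + ε := by
      intro b
      obtain ⟨j, hjt, hj⟩ := Set.mem_iUnion₂.1 (htc (Set.mem_univ b))
      have h1 : ∀ a, K a b ≤ K a j + ε := fun a => by
        have := hKδ (a := (a, b)) (b := (a, j)) (by simpa [Prod.dist_eq, hδ] using hj)
        linarith [(abs_lt.1 (Real.dist_eq _ _ ▸ this)).2]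
      calc ∫ a, K a b ∂(F : Measure X) ≤ ∫ a, (K a j + ε) ∂(F : Measure X) :=
            integral_mono (hint b F) ((hint j F).add (integrable_const _)) h1
        _ = ∫ a, K a j ∂(F : Measure X) + ε := by
            rw [integral_add (hint j F) (integrable_const _)]; simp
        _ ≤ c + ε := by linarith [hF ⟨j, hjt⟩]
    rw [mixedPayoff_eq_integral_integral hK]
    calc _ ≤ ∫ _, (c + ε) ∂(G : Measure Y) :=
          integral_mono (integrable_prod_of_continuous hK F G).integral_prod_right
            (integrable_const _) hb
      _ = c + ε := by simp
  · push Not at h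
    obtain ⟨w, hw0, hw1, hw⟩ := exists_weights_of_forall_exists_le
      (convex_range_integral (g := fun a (j : t) => K a j) fun j F => hint j F)
      (Set.range_nonempty (h := ⟨⟨Measure.dirac (Classical.arbitrary X), inferInstance⟩⟩) _)
      (c := c) (by rintro _ ⟨F, rfl⟩; exact h F)
    obtain ⟨G, hG⟩ := exists_probabilityMeasure_integral_eq_sum (fun j : t => (j : Y)) hw0 hw1
    refine Or.inr ⟨G, fun F => ?_⟩
    rw [mixedPayoff_eq_integral_integral hK, hG]
    exact hw _ ⟨F, rfl⟩

/-- A zero-sum game with continuous payoff on nonempty compact metric spaces has a value in mixed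
strategies. -/
theorem exists_hasGameValue_of_continuous [Nonempty X] [Nonempty Y]
    (hK : Continuous fun p : X × Y => K p.1 p.2) : ∃ v : ℝ, HasGameValue K v := by
  have hFne : Nonempty (ProbabilityMeasure X) :=
    ⟨⟨Measure.dirac (Classical.arbitrary X), inferInstance⟩⟩
  have hGne : Nonempty (ProbabilityMeasure Y) :=
    ⟨⟨Measure.dirac (Classical.arbitrary Y), inferInstance⟩⟩
  obtain ⟨M, hM⟩ := isCompact_univ.exists_bound_of_continuousOn hK.continuousOn
  have hbd : ∀ F G, |mixedPayoff K F G| ≤ M := fun F G => by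
    refine (norm_integral_le_of_norm_le_const (.of_forall fun p => hM p trivial)).trans ?_
    simp
  have hle : lowerValue K ≤ upperValue K := iSup_iInf_le_iInf_iSup _
  have hge : upperValue K ≤ lowerValue K := by
    by_contra! hlt
    obtain ⟨c, hlc, hcu⟩ := EReal.lt_iff_exists_real_btwn.1 hlt
    obtain ⟨d, hcd, hdu⟩ := EReal.lt_iff_exists_real_btwn.1 hcu
    have hcd' : c < d := EReal.coe_lt_coe_iff.1 hcd
    rcases exists_forall_mixedPayoff_le_or_le hK c (sub_pos.2 hcd') with ⟨F, hF⟩ | ⟨G, hG⟩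
    · refine absurd hdu (not_lt.2 ((iInf_le _ F).trans (iSup_le fun G => ?_)))
      exact EReal.coe_le_coe_iff.2 ((hF G).trans_eq (by ring))
    · refine absurd hlc (not_lt.2 (le_trans ?_ (le_iSup _ G)))
      exact le_iInf fun F => EReal.coe_le_coe_iff.2 (hG F)
  have htop : upperValue K ≠ ⊤ := by
    refine ne_top_of_le_ne_top (EReal.coe_ne_top M)
      ((iInf_le _ (Classical.arbitrary _)).trans (iSup_le fun G => ?_))
    exact EReal.coe_le_coe_iff.2 (abs_le.1 (hbd _ G)).2
  have hbot : upperValue K ≠ ⊥ := by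
    refine ne_bot_of_le_ne_bot (EReal.coe_ne_bot (-M)) (le_iInf fun F => ?_)
    exact le_iSup_of_le (Classical.arbitrary (ProbabilityMeasure Y))
      (EReal.coe_le_coe_iff.2 (abs_le.1 (hbd F _)).1)
  have hv := EReal.coe_toReal htop hbot
  exact ⟨(upperValue K).toReal, integrable_prod_of_continuous hK, hv.symm,
    (hle.antisymm hge).trans hv.symm⟩

/-- If a measurable involution `τ` exchanging the players reverses the sign of the payoff, the only
possible value is `0`: answering `F` by its image under `τ` makes the expected payoff vanish. -/
theorem HasGameValue.eq_zero_of_antisymm {X : Type*} [MeasurableSpace X] {K : X → X → ℝ} {v : ℝ}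
    (hv : HasGameValue K v) {τ : X → X} (hτ : Measurable τ) (hinv : Function.Involutive τ)
    (hK : ∀ a b, K (τ b) (τ a) = -K a b) : v = 0 := by
  let T : ProbabilityMeasure X → ProbabilityMeasure X := fun F => F.map hτ.aemeasurable
  have hT : ∀ F : ProbabilityMeasure X, MeasurePreserving τ (F : Measure X) (T F : Measure X) := fun F => ⟨hτ, rfl⟩
  have hT' : ∀ F : ProbabilityMeasure X, MeasurePreserving τ (T F : Measure X) (F : Measure X) := fun F =>
    ⟨hτ, by simp [T, ProbabilityMeasure.toMeasure_map, Measure.map_map hτ hτ,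
      hinv.comp_self]⟩
  let e : X × X ≃ᵐ X × X :=
    MeasurableEquiv.prodComm.trans
      ((⟨hinv.toPerm, hτ, hτ⟩ : X ≃ᵐ X).prodCongr ⟨hinv.toPerm, hτ, hτ⟩)
  have key : ∀ F : ProbabilityMeasure X, mixedPayoff K F (T F) = 0 := by
    intro F
    have hmp : MeasurePreserving e ((F : Measure X).prod (T F : Measure X))
        ((F : Measure X).prod (T F : Measure X)) :=
      ((hT' F).prod (hT F)).comp Measure.measurePreserving_swap
    have h1 := hmp.integral_comp' (g := fun p : X × X => K p.1 p.2)
    have h2 : ∀ p : X × X, K (e p).1 (e p).2 = -K p.1 p.2 := fun p => hK p.1 p.2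
    simp only [h2, integral_neg] at h1
    unfold mixedPayoff
    linarith
  have hT2 : ∀ F, T (T F) = F := fun F => Subtype.ext (hT' F).map_eq
  refine le_antisymm ?_ ?_
  · rw [← EReal.coe_le_coe_iff, ← hv.lower_eq]
    refine iSup_le fun G => (iInf_le _ (T G)).trans ?_
    have := key (T G)
    rw [hT2] at this
    rw [this]
  · rw [← EReal.coe_le_coe_iff, ← hv.upper_eq]
    refine le_iInf fun F => le_trans ?_ (le_iSup _ (T F))
    rw [key]

end Minimax

/-! ### The law of the fair settlement -/

section ArbiterLaw

/-- Completing the square in the quadratic form of `covMatrix2`, which shows that it is positive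
definite when `ρ ^ 2 < 1`. -/
theorem covMatrix2_dotProduct_mulVec (σx σy ρ : ℝ) (x : Fin 2 → ℝ) :
    x ⬝ᵥ (covMatrix2 σx σy ρ).mulVec x =
      (σx * x 0 + ρ * σy * x 1) ^ 2 + (1 - ρ ^ 2) * (σy * x 1) ^ 2 := by
  simp [covMatrix2, dotProduct, Matrix.mulVec, Fin.sum_univ_two]
  ring

variable {σx σy ρ : ℝ}

theorem posSemidef_covMatrix2 (hρ : -1 < ρ) (hρ' : ρ < 1) :
    (covMatrix2 σx σy ρ).PosSemidef := by
  refine .of_dotProduct_mulVec_nonneg ?_ fun x => ?_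
  · ext i j; fin_cases i <;> fin_cases j <;> simp [covMatrix2]
  · have : 0 ≤ 1 - ρ ^ 2 := by nlinarith
    rw [star_trivial, covMatrix2_dotProduct_mulVec]
    positivity

theorem covMatrix2_dotProduct_mulVec_pos (hσx : 0 < σx) (hσy : 0 < σy) (hρ : -1 < ρ)
    (hρ' : ρ < 1) {x : Fin 2 → ℝ} (hx : x ≠ 0) :
    0 < x ⬝ᵥ (covMatrix2 σx σy ρ).mulVec x := by
  have h : 0 < 1 - ρ ^ 2 := by nlinarith
  rw [covMatrix2_dotProduct_mulVec]
  by_cases h1 : x 1 = 0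
  · have h0 : x 0 ≠ 0 := fun h0 => hx (by ext i; fin_cases i <;> assumption)
    simp only [h1, mul_zero, add_zero]
    have := hσx.ne'
    positivity
  · have := hσy.ne'
    positivity

instance : IsProbabilityMeasure (arbiterLaw σx σy ρ) := by unfold arbiterLaw; infer_instance

/-- `N(0, Σ)` is a linear image of the standard Gaussian, which is invariant under the isometry
`z ↦ -z`. -/
theorem measurePreserving_neg_arbiterLaw :
    MeasurePreserving (fun z => -z) (arbiterLaw σx σy ρ) (arbiterLaw σx σy ρ) := by
  refine ⟨measurable_neg, ?_⟩
  have h := stdGaussian_map (LinearIsometryEquiv.neg ℝ (E := EuclideanSpace ℝ (Fin 2)))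
  unfold arbiterLaw multivariateGaussian
  conv_rhs => rw [← h]
  rw [Measure.map_map (by fun_prop) (by fun_prop), Measure.map_map (by fun_prop) (by fun_prop)]
  congr 1
  ext1 z
  simp

/-- Lines are null: a nonzero linear functional of `N(0, Σ)` is a one-dimensional Gaussian with
positive variance, which has no atoms. -/
theorem arbiterLaw_inner_eq_null (hσx : 0 < σx) (hσy : 0 < σy) (hρ : -1 < ρ) (hρ' : ρ < 1)
    {c : EuclideanSpace ℝ (Fin 2)} (hc : c ≠ 0) (r : ℝ) :
    arbiterLaw σx σy ρ {z | inner ℝ c z = r} = 0 := by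
  have hvar : Var[fun z => inner ℝ c z; arbiterLaw σx σy ρ] ≠ 0 := by
    unfold arbiterLaw
    rw [← covarianceBilin_self IsGaussian.memLp_two_id,
      covarianceBilin_multivariateGaussian (posSemidef_covMatrix2 hρ hρ')]
    exact (covMatrix2_dotProduct_mulVec_pos hσx hσy hρ hρ' fun h => hc (by ext i; simp [h])).ne'
  have : IsGaussian (arbiterLaw σx σy ρ) := by unfold arbiterLaw; infer_instance
  have hmap := IsGaussian.map_eq_gaussianReal (μ := arbiterLaw σx σy ρ) (innerSL ℝ c)
  have hmeas : {z | inner ℝ c z = r} = innerSL ℝ c ⁻¹' {r} := by ext z; simp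
  have hv : (Var[innerSL ℝ c; arbiterLaw σx σy ρ]).toNNReal ≠ 0 :=
    (Real.toNNReal_pos.2 ((variance_nonneg _ _).lt_of_ne' hvar)).ne'
  have := nullSingletonClass_gaussianReal (μ := (arbiterLaw σx σy ρ)[innerSL ℝ c]) hv
  rw [hmeas, ← Measure.map_apply (by fun_prop) (measurableSet_singleton r), hmap]
  exact measure_singleton r

end ArbiterLaw

/-! ### Continuity and antisymmetry of the payoff -/

section Payoff

theorem closerToII_eq (a b : EuclideanSpace ℝ (Fin 2)) : closerToII a b = closerToI b a := rfl

theorem isOpen_closerToI (a b : EuclideanSpace ℝ (Fin 2)) : IsOpen (closerToI a b) :=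
  isOpen_lt (by fun_prop) (by fun_prop)

theorem preimage_neg_closerToI (a b : EuclideanSpace ℝ (Fin 2)) :
    (fun z => -z) ⁻¹' closerToI (-a) (-b) = closerToI a b := by
  ext z
  simp only [closerToI, Set.mem_preimage, Set.mem_ofPred_eq, PiLp.neg_apply]
  ring_nf

variable {P : Measure (EuclideanSpace ℝ (Fin 2))}

/-- Points equidistant from two different offers carry no mass. -/
def BisectorsNull (P : Measure (EuclideanSpace ℝ (Fin 2))) : Prop :=
  ∀ a b : EuclideanSpace ℝ (Fin 2), a ≠ b →
    ∀ᵐ z ∂P, (a 0 - z 0) ^ 2 + (a 1 - z 1) ^ 2 ≠ (b 0 - z 0) ^ 2 + (b 1 - z 1) ^ 2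

theorem bisectorsNull_arbiterLaw {σx σy ρ : ℝ} (hσx : 0 < σx) (hσy : 0 < σy) (hρ : -1 < ρ)
    (hρ' : ρ < 1) : BisectorsNull (arbiterLaw σx σy ρ) := by
  intro a b hab
  rw [ae_iff]
  refine measure_mono_null ?_ (arbiterLaw_inner_eq_null hσx hσy hρ hρ' (sub_ne_zero.2 hab)
    ((a 0 ^ 2 + a 1 ^ 2 - b 0 ^ 2 - b 1 ^ 2) / 2))
  intro z hz
  simp only [ne_eq, not_not, Set.mem_ofPred_eq] at hz
  simp only [PiLp.inner_apply, Fin.sum_univ_two, PiLp.sub_apply, RCLike.inner_apply,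
    conj_trivial, Set.mem_ofPred_eq]
  linarith

theorem real_closerToI_add_real_closerToII [IsProbabilityMeasure P] (hP : BisectorsNull P)
    {a b : EuclideanSpace ℝ (Fin 2)} (hab : a ≠ b) :
    P.real (closerToI a b) + P.real (closerToII a b) = 1 := by
  have hd : Disjoint (closerToI a b) (closerToII a b) :=
    Set.disjoint_left.2 fun z h1 h2 => lt_asymm (α := ℝ) h1 h2
  rw [← measureReal_union hd (isOpen_closerToI b a).measurableSet, ← probReal_univ (μ := P)]
  refine measureReal_congr ?_
  filter_upwards [hP a b hab] with z hz
  exact propext ⟨fun _ => trivial, fun _ => lt_or_gt_of_ne hz⟩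

open Filter Topology in
/-- A point off the bisector of the two offers stays on its side when the offers move slightly, so
the indicators of the half-planes converge almost everywhere. -/
theorem continuousAt_real_closerToI [IsProbabilityMeasure P] (hP : BisectorsNull P)
    {p : EuclideanSpace ℝ (Fin 2) × EuclideanSpace ℝ (Fin 2)} (hp : p.1 ≠ p.2) :
    ContinuousAt (fun q : EuclideanSpace ℝ (Fin 2) × EuclideanSpace ℝ (Fin 2) =>
      P.real (closerToI q.1 q.2)) p := by
  refine (ENNReal.tendsto_toReal (measure_ne_top _ _)).comp
    (tendsto_measure_of_ae_tendsto_indicator_of_isFiniteMeasure (𝓝 p)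
      (isOpen_closerToI _ _).measurableSet (fun q => (isOpen_closerToI _ _).measurableSet) ?_)
  filter_upwards [hP p.1 p.2 hp] with z hz
  have hf : Continuous fun q : EuclideanSpace ℝ (Fin 2) × EuclideanSpace ℝ (Fin 2) =>
      (q.1 0 - z 0) ^ 2 + (q.1 1 - z 1) ^ 2 := by fun_prop
  have hg : Continuous fun q : EuclideanSpace ℝ (Fin 2) × EuclideanSpace ℝ (Fin 2) =>
      (q.2 0 - z 0) ^ 2 + (q.2 1 - z 1) ^ 2 := by fun_prop
  rcases lt_or_gt_of_ne hz with h | h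
  · filter_upwards [hf.continuousAt.eventually_lt hg.continuousAt h] with q hq
    exact ⟨fun _ => h, fun _ => hq⟩
  · filter_upwards [hg.continuousAt.eventually_lt hf.continuousAt h] with q hq
    exact ⟨fun h' => absurd hq (lt_asymm h'), fun h' => absurd h (lt_asymm h')⟩

/-- The payoff lies between the totals of the two offers, so it is close to any number that both
totals are close to. -/
theorem abs_foaPayoff_sub_le [IsProbabilityMeasure P] (hP : BisectorsNull P)
    (a b : EuclideanSpace ℝ (Fin 2)) (r : ℝ) :
    |foaPayoff P a b - r| ≤ |a 0 + a 1 - r| + |b 0 + b 1 - r| := by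
  unfold foaPayoff
  split_ifs with hab
  · exact le_add_of_nonneg_right (abs_nonneg _)
  · have h := real_closerToI_add_real_closerToII hP hab
    set p := P.real (closerToI a b) with hp
    set q := P.real (closerToII a b) with hq
    have hp0 : 0 ≤ p := measureReal_nonneg
    have hq0 : 0 ≤ q := measureReal_nonneg
    have e : (a 0 + a 1) * p + (b 0 + b 1) * q - r =
        p * (a 0 + a 1 - r) + q * (b 0 + b 1 - r) := by linear_combination r * h
    rw [e]
    refine (abs_add_le _ _).trans ?_
    rw [abs_mul, abs_mul, abs_of_nonneg hp0, abs_of_nonneg hq0]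
    exact add_le_add (mul_le_of_le_one_left (abs_nonneg _) (by linarith))
      (mul_le_of_le_one_left (abs_nonneg _) (by linarith))

open Filter Topology in
/-- The half-plane probabilities are discontinuous on the diagonal, but the payoff is not: there it
is squeezed between the totals of the two offers. -/
theorem continuous_foaPayoff [IsProbabilityMeasure P] (hP : BisectorsNull P) :
    Continuous fun p : EuclideanSpace ℝ (Fin 2) × EuclideanSpace ℝ (Fin 2) =>
      foaPayoff P p.1 p.2 := by
  refine continuous_iff_continuousAt.2 fun ⟨a, b⟩ => ?_
  by_cases hab : a = b
  · subst hab
    have hr : foaPayoff P a a = a 0 + a 1 := if_pos rfl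
    have hlim : Tendsto (fun p : EuclideanSpace ℝ (Fin 2) × EuclideanSpace ℝ (Fin 2) =>
        |p.1 0 + p.1 1 - (a 0 + a 1)| + |p.2 0 + p.2 1 - (a 0 + a 1)|) (𝓝 (a, a)) (𝓝 0) := by
      refine Continuous.tendsto' (by fun_prop) _ _ (by simp)
    refine tendsto_iff_dist_tendsto_zero.2 (squeeze_zero (fun _ => dist_nonneg) (fun p => ?_) hlim)
    change |foaPayoff P p.1 p.2 - foaPayoff P a a| ≤ _
    rw [hr]
    exact abs_foaPayoff_sub_le hP _ _ _
  · have h1 := continuousAt_real_closerToI hP (p := (a, b)) hab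
    have h2 : ContinuousAt (fun q : EuclideanSpace ℝ (Fin 2) × EuclideanSpace ℝ (Fin 2) =>
        P.real (closerToII q.1 q.2)) (a, b) :=
      ContinuousAt.comp (f := Prod.swap) (x := (a, b))
        (continuousAt_real_closerToI hP (p := (b, a)) (Ne.symm hab)) continuous_swap.continuousAt
    have h3 : ContinuousAt (fun q : EuclideanSpace ℝ (Fin 2) × EuclideanSpace ℝ (Fin 2) =>
        (q.1 0 + q.1 1) * P.real (closerToI q.1 q.2) +
          (q.2 0 + q.2 1) * P.real (closerToII q.1 q.2)) (a, b) :=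
      ((by fun_prop : Continuous fun q : EuclideanSpace ℝ (Fin 2) × EuclideanSpace ℝ (Fin 2) =>
        q.1 0 + q.1 1).continuousAt.mul h1).add
      ((by fun_prop : Continuous fun q : EuclideanSpace ℝ (Fin 2) × EuclideanSpace ℝ (Fin 2) =>
        q.2 0 + q.2 1).continuousAt.mul h2)
    refine h3.congr ?_
    filter_upwards [(isOpen_ne_fun continuous_fst continuous_snd).mem_nhds hab] with q hq
    exact (if_neg hq).symm

/-- Reflecting both offers in the origin and exchanging the players reverses the payoff. -/
theorem foaPayoff_neg_neg (hP : MeasurePreserving (fun z => -z) P P)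
    (a b : EuclideanSpace ℝ (Fin 2)) : foaPayoff P (-b) (-a) = -foaPayoff P a b := by
  have h : ∀ a b, P.real (closerToI (-a) (-b)) = P.real (closerToI a b) := fun a b => by
    rw [← preimage_neg_closerToI a b]
    exact (hP.measureReal_preimage (isOpen_closerToI _ _).measurableSet.nullMeasurableSet).symm
  unfold foaPayoff
  simp only [neg_inj, closerToII_eq, h, PiLp.neg_apply, eq_comm (a := b)]
  split_ifs with hab
  · subst hab; ring
  · ring

end Payoff

theorem mainTheorem5 (σx σy ρ : ℝ) (hσx : 0 < σx) (hσy : 0 < σy) (hρ : -1 < ρ) (hρ' : ρ < 1)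
    (S : Set (EuclideanSpace ℝ (Fin 2))) (hS : IsCompact S) (hne : S.Nonempty) :
    (∃ v : ℝ, HasGameValue (foaGame σx σy ρ S) v) ∧
      ((∀ a ∈ S, -a ∈ S) → HasGameValue (foaGame σx σy ρ S) 0) := by
  have : CompactSpace S := isCompact_iff_compactSpace.1 hS
  have : Nonempty S := hne.to_subtype
  have hK : Continuous fun p : S × S => foaGame σx σy ρ S p.1 p.2 :=
    (continuous_foaPayoff (bisectorsNull_arbiterLaw hσx hσy hρ hρ')).comp
      ((continuous_subtype_val.comp continuous_fst).prodMk
        (continuous_subtype_val.comp continuous_snd))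
  obtain ⟨v, hv⟩ := exists_hasGameValue_of_continuous hK
  refine ⟨⟨v, hv⟩, fun hsymm => ?_⟩
  have hv0 : v = 0 := hv.eq_zero_of_antisymm (τ := fun a => ⟨-a, hsymm a a.2⟩)
    (measurable_subtype_coe.neg.subtype_mk) (fun a => Subtype.ext (neg_neg _))
    fun a b => foaPayoff_neg_neg measurePreserving_neg_arbiterLaw (a : EuclideanSpace ℝ (Fin 2)) b
  exact hv0 ▸ hv
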